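/- Let $G$ be a locally compact Polish group whose topology is induced by some two-sided invariant metric, i.e. a metric $\rho$ with $\rho(zx,zy)=\rho(x,y)=\rho(xz,yz)$ for all $x,y,z\in G$ (e.g. any compact Polish group or any locally compact abelian Polish group). Let $d$ be any metric on $G$ inducing its topology (not necessarily invariant), and let $X\subseteq G$. Then the following are equivalent: 1. $X$ is meager-additive: for every meager set $M\subseteq G$ the set $MX=\{mx : m\in M,\ x\in X\}$ is meager; 2. $X$ is sharply meager-additive: for every meager set $M\subseteq G$ there is a $\sigma$-compact set $K\supseteq X$ such that $MK$ is meager; 3. $X$ has sharp measure zero with respect to $d$: for every sequence $(\varepsilon_n)_{n\in\mathbb N}$ of positive reals there are sets $U_n\subseteq G$ ($n\in\mathbb N$) with $d$-diameter $\operatorname{diam}U_n\le\varepsilon_n$ for all $n$, and a partition of $\mathbb N$ into consecutive finite intervals $I_0,I_1,I_2,\dots$, such that every $x\in X$ belongs to $\bigcup_{n\in I_j}U_n$ for all but finitely many $j$. -/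

import Mathlib

open scoped Pointwise

/-- The sequence of sets `U` is a `γ`-cover of `S`: each point of `S` belongs to all but finitely
many of the sets `U n`. -/
def IsGammaCover {α : Type*} (S : Set α) (U : ℕ → Set α) : Prop :=
  ∀ x ∈ S, ∀ᶠ n in Filter.atTop, x ∈ U n

/-- The sequence of sets `U` is a `γ`-groupable cover of `S`: there is a partition of `ℕ` into
consecutive finite intervals `I j = [k j, k (j + 1))` such that the sequence of the unions
`⋃ n ∈ I j, U n` is a `γ`-cover of `S`. -/
def IsGammaGroupableCover {α : Type*} (S : Set α) (U : ℕ → Set α) : Prop :=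
  ∃ k : ℕ → ℕ, k 0 = 0 ∧ StrictMono k ∧
    IsGammaCover S (fun j => ⋃ n ∈ Set.Ico (k j) (k (j + 1)), U n)

/-- The subset `S` of a metric space has sharp measure zero: for every sequence `ε` of positive
reals there is a `γ`-groupable cover `U` of `S` such that `diam (U n) ≤ ε n` for all `n`.
The diameter is the extended one, so that unbounded sets have infinite diameter. -/
def HasSharpMeasureZero {α : Type*} [MetricSpace α] (S : Set α) : Prop :=
  ∀ ε : ℕ → ℝ, (∀ n, 0 < ε n) →
    ∃ U : ℕ → Set α, IsGammaGroupableCover S U ∧ ∀ n, Metric.ediam (U n) ≤ ENNReal.ofReal (ε n)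

/-- The set `X` is meager-additive: `M * X` is meager for every meager set `M`. -/
def IsMeagerAdditive {G : Type*} [Group G] [TopologicalSpace G] (X : Set G) : Prop :=
  ∀ M : Set G, IsMeagre M → IsMeagre (M * X)

/-- The set `X` is sharply meager-additive: for every meager set `M` there is a `σ`-compact set
`K ⊇ X` such that `M * K` is meager. -/
def IsSharplyMeagerAdditive {G : Type*} [Group G] [TopologicalSpace G] (X : Set G) : Prop :=
  ∀ M : Set G, IsMeagre M → ∃ K : Set G, IsSigmaCompact K ∧ X ⊆ K ∧ IsMeagre (M * K)

/-- The topology of `G` is induced by some two-sided invariant metric. -/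
def AdmitsInvariantMetric (G : Type*) [Group G] [t : TopologicalSpace G] : Prop :=
  ∃ d : MetricSpace G, d.toPseudoMetricSpace.toUniformSpace.toTopologicalSpace = t ∧
    ∀ x y z : G, d.dist (z * x) (z * y) = d.dist x y ∧ d.dist (x * z) (y * z) = d.dist x y

/-! Sharp measure zero survives continuous images of `σ`-compact spaces, hence depends only on the
topology, and the metric may be taken invariant; 2 → 1 is monotonicity.

3 → 2: cover `M` by increasing compact nowhere dense `N n` and choose scales `δ n` so fast that
every `δ n`-ball contains a `δ (n + 1)`-ball missing `N n * U n`, whenever `diam U n ≤ δ (n + 1)`.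
Crossing one block of indices escapes `N i * F`, where `F` is a compact set approximated by the
block's union.

1 → 3: remove small balls around ever finer finite nets to get a closed nowhere dense `M`, and cover
`M * X` by compact nowhere dense `F i`. For `x ∈ X`, a Baire argument on the tree of balls defining
`M` finds a node below which every ball meets `F i * x⁻¹`. A ball chosen to miss `F j * x⁻¹` is thus
no node, so its centre is near a net point; this puts `x` near one of finitely many points not
depending on `x`. -/

/-- Dependent choice of a sequence satisfying an invariant and a relation between consecutive
terms. -/
theorem exists_seq_of_forall_exists {σ : Type*} (P : ℕ → σ → Prop) (R : ℕ → σ → σ → Prop)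
    (s₀ : σ) (h₀ : P 0 s₀) (h : ∀ n s, P n s → ∃ s', P (n + 1) s' ∧ R n s s') :
    ∃ s : ℕ → σ, s 0 = s₀ ∧ (∀ n, P n (s n)) ∧ ∀ n, R n (s n) (s (n + 1)) := by
  choose! f hP hR using h
  let s : ℕ → σ := fun n => Nat.rec s₀ (fun n a => f n a) n
  have hs : ∀ n, P n (s n) := by
    intro n
    induction n with
    | zero => exact h₀
    | succ n ih => exact hP n _ ih
  exact ⟨s, rfl, hs, fun n => hR n _ (hs n)⟩

/-- A compact nowhere dense subset of a metric space is uniformly nowhere dense. -/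
theorem IsCompact.exists_forall_disjoint_closedBall {α : Type*} [MetricSpace α] {N : Set α}
    (hN : IsCompact N) (hN' : IsNowhereDense N) {δ : ℝ} (hδ : 0 < δ) :
    ∃ ε > 0, ∀ w, ∃ z, dist z w < δ ∧ Disjoint (Metric.closedBall z ε) N := by
  have hd : Dense Nᶜ := by
    have := hN.isClosed.isNowhereDense_iff.1 hN'
    exact interior_eq_empty_iff_dense_compl.1 this
  have key : ∀ p : α, ∃ z, dist z p < δ / 2 ∧ ∃ ε > 0, Disjoint (Metric.closedBall z ε) N := by
    intro p
    obtain ⟨z, hz, hzN⟩ := hd.exists_mem_open Metric.isOpen_ball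
      ⟨p, Metric.mem_ball_self (half_pos hδ)⟩
    obtain ⟨ε, hε, hsub⟩ := Metric.nhds_basis_closedBall.mem_iff.1
      (hN.isClosed.isOpen_compl.mem_nhds hz)
    exact ⟨z, hzN, ε, hε, Set.disjoint_left.2 fun y hy => hsub hy⟩
  choose z hz e he hdis using key
  obtain ⟨T, -, hT⟩ := hN.elim_nhds_subcover (fun p => Metric.ball p (δ / 4))
    fun p _ => Metric.ball_mem_nhds p (by positivity)
  obtain ⟨ε, hε, hεT⟩ : ∃ ε > 0, ∀ p ∈ T, ε ≤ e p := by
    rcases T.eq_empty_or_nonempty with rfl | hne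
    · exact ⟨1, one_pos, by simp⟩
    · exact ⟨T.inf' hne e, (Finset.lt_inf'_iff _).2 fun p _ => he p,
        fun p hp => Finset.inf'_le _ hp⟩
  -- Near `N`, a centre from the finite subcover works; at distance at least `δ / 4` from `N`, `w`
  -- itself does.
  refine ⟨min ε (δ / 8), by positivity, fun w => ?_⟩
  by_cases hw : ∃ p ∈ N, dist p w < δ / 4
  · obtain ⟨p, hpN, hpw⟩ := hw
    obtain ⟨c, hcT, hc⟩ := Set.mem_iUnion₂.1 (hT hpN)
    refine ⟨z c, ?_, (hdis c).mono_left
      (Metric.closedBall_subset_closedBall ((min_le_left _ _).trans (hεT c hcT)))⟩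
    have h1 := dist_triangle4 (z c) c p w
    rw [Metric.mem_ball, dist_comm] at hc
    linarith [hz c]
  · push Not at hw
    refine ⟨w, by simpa using hδ, Set.disjoint_left.2 fun y hy hyN => ?_⟩
    have h1 := hw y hyN
    have h2 : dist y w ≤ δ / 8 := (Metric.mem_closedBall.1 hy).trans (min_le_right _ _)
    linarith

/-- In a `σ`-compact metrizable space, a meagre set is covered by an increasing sequence of
compact nowhere dense sets. -/
theorem IsMeagre.exists_monotone_isCompact {α : Type*} [MetricSpace α] [SigmaCompactSpace α]
    {M : Set α} (hM : IsMeagre M) :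
    ∃ N : ℕ → Set α, Monotone N ∧ (∀ n, IsCompact (N n)) ∧ (∀ n, IsNowhereDense (N n)) ∧
      M ⊆ ⋃ n, N n := by
  obtain ⟨S, hS, hSc, hMS⟩ := isMeagre_iff_countable_union_isNowhereDense.1 hM
  obtain ⟨f, hf⟩ : ∃ f : ℕ → Set α, insert ∅ S = Set.range f :=
    (hSc.insert ∅).exists_eq_range (Set.insert_nonempty _ _)
  have hfn : ∀ n, IsNowhereDense (f n) := by
    intro n
    have : f n ∈ insert ∅ S := hf ▸ Set.mem_range_self n
    rcases this with h | h
    · rw [h]; exact isNowhereDense_empty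
    · exact hS _ h
  let N : ℕ → Set α := fun n => (⋃ i ∈ Finset.range (n + 1), closure (f i)) ∩ compactCovering α n
  have hcl : ∀ n, IsClosed (⋃ i ∈ Finset.range (n + 1), closure (f i)) := fun n =>
    isClosed_biUnion_finset fun i _ => isClosed_closure
  have hint : ∀ n, interior (⋃ i ∈ Finset.range n, closure (f i)) = ∅ := by
    intro n
    induction n with
    | zero => simp
    | succ n ih =>
      rw [Finset.range_add_one, Finset.set_biUnion_insert,
        interior_union_isClosed_of_interior_empty isClosed_closure ih]
      exact hfn n
  refine ⟨N, ?_, fun n => (isCompact_compactCovering α n).inter_left (hcl n), fun n => ?_, ?_⟩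
  · intro m n hmn
    refine Set.inter_subset_inter (Set.biUnion_subset_biUnion_left ?_)
      (compactCovering_subset α hmn)
    intro i hi
    simp only [Finset.coe_range, Set.mem_Iio] at hi ⊢
    omega
  · refine IsNowhereDense.mono Set.inter_subset_left ?_
    exact (hcl n).isNowhereDense_iff.2 (hint _)
  · intro x hx
    obtain ⟨s, hs, hxs⟩ := hMS hx
    obtain ⟨i, rfl⟩ : s ∈ Set.range f := hf ▸ Set.mem_insert_of_mem _ hs
    obtain ⟨m, hm⟩ := Set.mem_iUnion.1 ((iUnion_compactCovering α).symm ▸ Set.mem_univ x)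
    refine Set.mem_iUnion.2 ⟨max i m, Set.mem_iUnion₂.2 ⟨i, ?_, subset_closure hxs⟩,
      compactCovering_subset α (le_max_right _ _) hm⟩
    exact Finset.mem_range.2 (by omega)

/-! ### Sharp measure zero: invariance and constructions -/

/-- Sharp measure zero is preserved by continuous images of `σ`-compact spaces. -/
theorem HasSharpMeasureZero.image {α β : Type*} [MetricSpace α] [MetricSpace β]
    [SigmaCompactSpace α] {S : Set α} (hS : HasSharpMeasureZero S) {f : α → β}
    (hf : Continuous f) : HasSharpMeasureZero (f '' S) := by
  intro ε hε
  have key : ∀ n, ∃ δ > 0, ∀ x ∈ compactCovering α n, ∀ y ∈ compactCovering α n,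
      dist x y < δ → dist (f x) (f y) < ε n := fun n =>
    Metric.uniformContinuousOn_iff.1
      ((isCompact_compactCovering α n).uniformContinuousOn_of_continuous hf.continuousOn) _ (hε n)
  choose δ hδ hfδ using key
  obtain ⟨U, ⟨k, hk0, hk, hU⟩, hdiam⟩ := hS (fun n => δ n / 2) fun n => half_pos (hδ n)
  -- Cutting with the `n`-th compact set gives uniform continuity and loses no point for large `n`.
  refine ⟨fun n => f '' (U n ∩ compactCovering α n), ⟨k, hk0, hk, ?_⟩, fun n => ?_⟩
  · rintro _ ⟨x, hx, rfl⟩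
    obtain ⟨m, hm⟩ := Set.mem_iUnion.1 ((iUnion_compactCovering α).symm ▸ Set.mem_univ x)
    filter_upwards [hU x hx, Filter.eventually_ge_atTop m] with j hj hmj
    obtain ⟨n, hn, hxn⟩ := Set.mem_iUnion₂.1 hj
    refine Set.mem_iUnion₂.2 ⟨n, hn, x, ⟨hxn, compactCovering_subset α ?_ hm⟩, rfl⟩
    exact hmj.trans ((hk.id_le j).trans hn.1)
  · refine Metric.ediam_le ?_
    rintro _ ⟨x, hx, rfl⟩ _ ⟨y, hy, rfl⟩
    rw [edist_dist]
    refine ENNReal.ofReal_le_ofReal (hfδ n x hx.2 y hy.2 ?_).le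
    have h1 := (Metric.edist_le_ediam_of_mem hx.1 hy.1).trans (hdiam n)
    rw [edist_dist, ENNReal.ofReal_le_ofReal_iff (half_pos (hδ n)).le] at h1
    linarith [hδ n]

/-- Finite families of small sets, grouped into consecutive blocks, can be enumerated into a
`γ`-groupable cover. -/
theorem exists_isGammaGroupableCover_of_families {α : Type*} [MetricSpace α] {S : Set α}
    {ε : ℕ → ℝ} {b k : ℕ → ℕ} (hb0 : b 0 = 0) (hb : StrictMono b) (hk0 : k 0 = 0)
    (hk : StrictMono k) (U : ℕ → ℕ → Set α)
    (hdiam : ∀ n i, b n ≤ i → i < b (n + 1) → Metric.ediam (U n i) ≤ ENNReal.ofReal (ε i))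
    (hU : ∀ x ∈ S, ∀ᶠ j in Filter.atTop, ∃ n, k j ≤ n ∧ n < k (j + 1) ∧
      ∃ i, b n ≤ i ∧ i < b (n + 1) ∧ x ∈ U n i) :
    ∃ V : ℕ → Set α, IsGammaGroupableCover S V ∧
      ∀ n, Metric.ediam (V n) ≤ ENNReal.ofReal (ε n) := by
  refine ⟨fun i => {x | ∃ n, b n ≤ i ∧ i < b (n + 1) ∧ x ∈ U n i},
    ⟨b ∘ k, by simp [hk0, hb0], hb.comp hk, fun x hx => ?_⟩, fun i => Metric.ediam_le ?_⟩
  · filter_upwards [hU x hx] with j hj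
    obtain ⟨n, hn1, hn2, i, hi1, hi2, hxi⟩ := hj
    refine Set.mem_iUnion₂.2 ⟨i, ⟨(hb.monotone hn1).trans hi1, ?_⟩, n, hi1, hi2, hxi⟩
    exact hi2.trans_le (hb.monotone hn2)
  · rintro x ⟨n, hn1, hn2, hx⟩ y ⟨m, hm1, hm2, hy⟩
    have h1 : n < m + 1 := hb.lt_iff_lt.1 (hn1.trans_lt hm2)
    have h2 : m < n + 1 := hb.lt_iff_lt.1 (hm1.trans_lt hn2)
    obtain rfl : n = m := by omega
    exact (Metric.edist_le_ediam_of_mem hx hy).trans (hdiam n i hn1 hn2)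

/-- A countable set has sharp measure zero. -/
theorem Set.Countable.hasSharpMeasureZero {α : Type*} [MetricSpace α] {S : Set α}
    (hS : S.Countable) : HasSharpMeasureZero S := by
  intro ε hε
  rcases S.eq_empty_or_nonempty with rfl | hne
  · exact ⟨fun _ => ∅, ⟨id, rfl, strictMono_id, fun x hx => hx.elim⟩, by simp⟩
  obtain ⟨g, rfl⟩ := hS.exists_eq_range hne
  let b : ℕ → ℕ := fun n => ∑ m ∈ Finset.range n, (m + 1)
  have hbs : ∀ n, b (n + 1) = b n + (n + 1) := fun n => Finset.sum_range_succ _ _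
  refine exists_isGammaGroupableCover_of_families (b := b) (k := id) (by simp [b])
    (strictMono_nat_of_lt_succ fun n => by rw [hbs]; omega) rfl strictMono_id
    (fun n i => {g (i - b n)}) (by simp) ?_
  rintro _ ⟨a, rfl⟩
  filter_upwards [Filter.eventually_ge_atTop a] with j hj
  exact ⟨j, le_rfl, Nat.lt_succ_self j, b j + a, by omega, by rw [hbs]; omega, by simp⟩

theorem IsMeagre.of_subset_iUnion_isNowhereDense {α ι : Type*} [TopologicalSpace α] [Countable ι]
    {M : Set α} {N : ι → Set α} (hN : ∀ i, IsNowhereDense (N i)) (hM : M ⊆ ⋃ i, N i) :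
    IsMeagre M :=
  isMeagre_iff_countable_union_isNowhereDense.2
    ⟨Set.range N, by rintro _ ⟨i, rfl⟩; exact hN i, Set.countable_range N, hM⟩

theorem Finset.exists_injOn_nat_block {α : Type*} (s : Finset α) (b : ℕ) :
    ∃ e : α → ℕ, Set.InjOn e s ∧ ∀ a ∈ s, b ≤ e a ∧ e a < b + s.card := by
  classical
  refine ⟨fun a => if h : a ∈ s then b + s.equivFin ⟨a, h⟩ else 0, fun x hx y hy hxy => ?_,
    fun a ha => ?_⟩
  · have hx' : x ∈ s := hx
    have hy' : y ∈ s := hy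
    simp only [hx', hy', dif_pos, Nat.add_left_cancel_iff] at hxy
    simpa using s.equivFin.injective (Fin.ext hxy)
  · simp only [ha, dif_pos]
    have := (s.equivFin ⟨a, ha⟩).isLt
    omega

/-! ### The two implications for an invariant metric -/

section InvariantMetric

open Pointwise Filter Topology

/-- In a group with an invariant metric, sharp measure zero implies sharp meager-additivity. -/
theorem HasSharpMeasureZero.isSharplyMeagerAdditive {G : Type*} [Group G] [MetricSpace G]
    [IsIsometricSMul G G] [IsIsometricSMul Gᵐᵒᵖ G] [IsTopologicalGroup G] [SigmaCompactSpace G]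
    {X : Set G} (hX : HasSharpMeasureZero X) : IsSharplyMeagerAdditive X := by
  intro M hM
  obtain ⟨N, hNmono, hNc, hNnd, hMN⟩ := hM.exists_monotone_isCompact
  -- The factor in `2 * δ'` leaves one `δ'` for the new ball and one for the diameter of `U n`.
  obtain ⟨δ, hδ0, hδpos, hδ⟩ := exists_seq_of_forall_exists (fun _ (δ : ℝ) => 0 < δ)
    (fun n δ δ' => δ' ≤ δ / 2 ∧
      ∀ w, ∃ z, dist z w < δ / 2 ∧ Disjoint (Metric.closedBall z (2 * δ')) (N n)) 1 one_pos (by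
      intro n δ hδ
      obtain ⟨e, he, h⟩ := (hNc n).exists_forall_disjoint_closedBall (hNnd n) (half_pos hδ)
      refine ⟨min (e / 2) (δ / 2), by positivity, min_le_right _ _, fun w => ?_⟩
      obtain ⟨z, hz, hd⟩ := h w
      refine ⟨z, hz, hd.mono_left (Metric.closedBall_subset_closedBall ?_)⟩
      linarith [min_le_left (e / 2) (δ / 2)])
  have hδle : ∀ n, δ n ≤ (1 / 2) ^ n := by
    intro n
    induction n with
    | zero => simp [hδ0]
    | succ n ih => rw [pow_succ]; linarith [(hδ n).1]
  have hδlim : ∀ r > 0, ∃ n, ∀ m ≥ n, δ m < r := by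
    intro r hr
    obtain ⟨n, hn⟩ := exists_pow_lt_of_lt_one hr (by norm_num : (1 / 2 : ℝ) < 1)
    refine ⟨n, fun m hm => ((hδle m).trans ?_).trans_lt hn⟩
    exact pow_le_pow_of_le_one (by norm_num) (by norm_num) hm
  obtain ⟨U, ⟨k, hk0, hk, hU⟩, hdiam⟩ := hX (fun n => δ (n + 1)) fun n => hδpos _
  have hUdist : ∀ n, ∀ u ∈ U n, ∀ v ∈ U n, dist u v ≤ δ (n + 1) := by
    intro n u hu v hv
    have h1 := (Metric.edist_le_ediam_of_mem hu hv).trans (hdiam n)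
    rwa [edist_dist, ENNReal.ofReal_le_ofReal_iff (hδpos _).le] at h1
  have hstep : ∀ n w, ∃ w', Metric.closedBall w' (δ (n + 1)) ⊆ Metric.closedBall w (δ n) ∧
      Disjoint (Metric.closedBall w' (δ (n + 1))) (N n * U n) := by
    intro n w
    rcases (U n).eq_empty_or_nonempty with he | ⟨u, hu⟩
    · refine ⟨w, Metric.closedBall_subset_closedBall ?_, by simp [he]⟩
      linarith [(hδ n).1, hδpos n]
    -- By invariance `N n * U n` stays within `δ (n + 1)` of `N n * {u}`, so it suffices to escape
    -- `N n` near `w * u⁻¹` and translate back.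
    obtain ⟨z, hz, hd⟩ := (hδ n).2 (w * u⁻¹)
    refine ⟨z * u, Metric.closedBall_subset_closedBall' ?_, Set.disjoint_left.2 ?_⟩
    · have : dist (z * u) w = dist z (w * u⁻¹) := by
        rw [← dist_mul_right z (w * u⁻¹) u, inv_mul_cancel_right]
      linarith [(hδ n).1]
    · rintro _ hy ⟨p, hp, v, hv, rfl⟩
      refine Set.disjoint_left.1 hd (Metric.mem_closedBall.2 ?_) hp
      have h1 := dist_triangle (p * u) (p * v) (z * u)
      rw [dist_mul_right, dist_mul_left] at h1
      have h2 := hUdist n u hu v hv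
      have h3 : dist (p * v) (z * u) ≤ δ (n + 1) := hy
      linarith
  have hiter : ∀ a b, a ≤ b → ∀ w, ∃ w',
      Metric.closedBall w' (δ b) ⊆ Metric.closedBall w (δ a) ∧
      ∀ n, a ≤ n → n < b → Disjoint (Metric.closedBall w' (δ b)) (N n * U n) := by
    intro a b hab w
    induction b, hab using Nat.le_induction with
    | base => exact ⟨w, subset_rfl, fun n h1 h2 => absurd h1 (by omega)⟩
    | succ b hab ih =>
      obtain ⟨w₁, hw₁, hd₁⟩ := ih
      obtain ⟨w₂, hw₂, hd₂⟩ := hstep b w₁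
      refine ⟨w₂, hw₂.trans hw₁, fun n h1 h2 => ?_⟩
      rcases Nat.lt_succ_iff_lt_or_eq.1 h2 with h | rfl
      · exact (hd₁ n h1 h).mono_left hw₂
      · exact hd₂
  let A : ℕ → Set G := fun j => ⋃ n ∈ Set.Ico (k j) (k (j + 1)), U n
  let F : ℕ → Set G := fun m => (⋂ j ≥ m, closure (A j)) ∩ compactCovering G m
  have hFc : ∀ m, IsCompact (F m) := fun m => (isCompact_compactCovering G m).inter_left
    (isClosed_biInter fun j _ => isClosed_closure)
  have hNF : ∀ i m, IsNowhereDense (N i * F m) := by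
    intro i m
    refine ((hNc i).mul (hFc m)).isClosed.isNowhereDense_iff.2 ?_
    rw [Set.eq_empty_iff_forall_notMem]
    intro y hy
    obtain ⟨r, hr, hball⟩ := Metric.nhds_basis_closedBall.mem_iff.1 (mem_interior_iff_mem_nhds.1 hy)
    obtain ⟨n₀, hn₀⟩ := hδlim r hr
    obtain ⟨j, hjm, hji, hjn⟩ : ∃ j, m ≤ j ∧ i ≤ j ∧ n₀ ≤ j :=
      ⟨m + i + n₀, by omega, by omega, by omega⟩
    have hjk : j ≤ k j := hk.id_le j
    obtain ⟨w, hw, hd⟩ := hiter (k j) (k (j + 1)) (hk.monotone j.le_succ) y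
    have hwr : Metric.closedBall y (δ (k j)) ⊆ Metric.closedBall y r :=
      Metric.closedBall_subset_closedBall (hn₀ _ (by omega)).le
    obtain ⟨p, hp, f, hf, hpf⟩ := hball (hwr (hw (Metric.mem_closedBall_self (hδpos _).le)))
    -- Replacing `f` by `u ∈ A j` moves the product by less than the radius of the ball around `w`.
    obtain ⟨u, hu, hfu⟩ := Metric.mem_closure_iff.1 (Set.mem_iInter₂.1 hf.1 j hjm) _
      (hδpos (k (j + 1)))
    obtain ⟨n, hn, hun⟩ := Set.mem_iUnion₂.1 hu
    refine Set.disjoint_left.1 (hd n hn.1 hn.2) (Metric.mem_closedBall.2 ?_)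
      (Set.mul_mem_mul (hNmono (hji.trans (hjk.trans hn.1)) hp) hun)
    rw [← hpf]
    simpa only [dist_mul_left, dist_comm u f] using hfu.le
  refine ⟨⋃ m, F m, isSigmaCompact_iUnion_of_isCompact F hFc, fun x hx => ?_, ?_⟩
  · obtain ⟨m₁, hm₁⟩ := eventually_atTop.1 (hU x hx)
    obtain ⟨m₂, hm₂⟩ := Set.mem_iUnion.1 ((iUnion_compactCovering G).symm ▸ Set.mem_univ x)
    refine Set.mem_iUnion.2 ⟨max m₁ m₂, Set.mem_iInter₂.2 fun j hj => subset_closure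
      (hm₁ j ((le_max_left _ _).trans hj)), compactCovering_subset G (le_max_right _ _) hm₂⟩
  · refine IsMeagre.of_subset_iUnion_isNowhereDense (fun q : ℕ × ℕ => hNF q.1 q.2) ?_
    rintro _ ⟨y, hy, z, hz, rfl⟩
    obtain ⟨i, hi⟩ := Set.mem_iUnion.1 (hMN hy)
    obtain ⟨m, hm⟩ := Set.mem_iUnion.1 hz
    exact Set.mem_iUnion.2 ⟨(i, m), Set.mul_mem_mul hi hm⟩

/-- In a nondiscrete group with an invariant metric, meager-additivity implies sharp measure
zero. -/
theorem IsMeagerAdditive.hasSharpMeasureZero {G : Type*} [Group G] [MetricSpace G]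
    [IsIsometricSMul G G] [IsIsometricSMul Gᵐᵒᵖ G] [IsTopologicalGroup G] [SigmaCompactSpace G]
    [LocallyCompactSpace G] [∀ x : G, (𝓝[≠] x).NeBot]
    {X : Set G} (hX : IsMeagerAdditive X) : HasSharpMeasureZero X := by
  intro ε hε
  obtain ⟨C⟩ : Nonempty (CompactExhaustion G) := ⟨default⟩
  obtain ⟨t₀, ht₀, hC₀⟩ : ∃ t₀ > 0, IsCompact (Metric.closedBall (1 : G) t₀) := by
    obtain ⟨K, hK, hK1⟩ := exists_compact_mem_nhds (1 : G)
    obtain ⟨t, ht, hsub⟩ := Metric.nhds_basis_closedBall.mem_iff.1 hK1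
    exact ⟨t, ht, hK.of_isClosed_subset Metric.isClosed_closedBall hsub⟩
  have hnet : ∀ n (Q : Finset G) (r : ℝ), 0 < r →
      ∃ Q' : Finset G, Q ⊆ Q' ∧ Q'.Nonempty ∧ ∀ x ∈ C n, ∃ q ∈ Q', dist x q < r := by
    classical
    intro n Q r hr
    obtain ⟨T, -, hT⟩ := (C.isCompact n).elim_nhds_subcover (fun p => Metric.ball p r)
      fun p _ => Metric.ball_mem_nhds p hr
    refine ⟨insert 1 (Q ∪ T), fun q hq => by simp [hq], by simp, fun x hx => ?_⟩
    obtain ⟨q, hq, hxq⟩ := Set.mem_iUnion₂.1 (hT hx)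
    exact ⟨q, by simp [hq], hxq⟩
  have hfin : ∀ Q : Finset G, IsNowhereDense (Q : Set G) := fun Q =>
    Q.finite_toSet.isClosed.isNowhereDense_iff.2
      (interior_eq_empty_iff_dense_compl.2
        (Set.compl_eq_univ_sdiff (Q : Set G) ▸ dense_univ.sdiff_finset Q))
  obtain ⟨Q₀, -, hQ₀ne, hQ₀⟩ := hnet 0 ∅ (t₀ / 4) (by positivity)
  -- The state is a scale, a finite net and the start of an index block with one index per pair of
  -- net points. The bound `4 * s'.1 ≤ ε i` anticipates covering sets of radius `2 * s'.1`.
  obtain ⟨s, hs0, hsP, hsR⟩ := exists_seq_of_forall_exists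
    (fun n (s : ℝ × Finset G × ℕ) => 0 < s.1 ∧ s.2.1.Nonempty ∧
      ∀ x ∈ C n, ∃ q ∈ s.2.1, dist x q < s.1 / 4)
    (fun n s s' => s'.1 ≤ s.1 / 2 ∧ s.2.1 ⊆ s'.2.1 ∧
      s'.2.2 = s.2.2 + (s.2.1 ×ˢ s.2.1).card ∧ (∀ i < s'.2.2, 4 * s'.1 ≤ ε i) ∧
      ∀ v, ∃ v', dist v' v < s.1 / 2 ∧ ∀ q ∈ s.2.1, 2 * s'.1 ≤ dist v' q)
    (t₀, Q₀, 0) ⟨ht₀, hQ₀ne, hQ₀⟩ (by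
      rintro n ⟨t, Q, b⟩ ⟨ht, -, -⟩
      obtain ⟨e, he, h⟩ := Q.finite_toSet.isCompact.exists_forall_disjoint_closedBall (hfin Q)
        (half_pos ht)
      obtain ⟨c, hc, hcε⟩ : ∃ c > 0, ∀ i < b + (Q ×ˢ Q).card, c ≤ ε i := by
        generalize b + (Q ×ˢ Q).card = m
        induction m with
        | zero => exact ⟨1, one_pos, by simp⟩
        | succ m ih =>
          obtain ⟨c, hc, h⟩ := ih
          refine ⟨min c (ε m), lt_min hc (hε m), fun i hi => ?_⟩
          rcases Nat.lt_succ_iff_lt_or_eq.1 hi with h' | rfl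
          · exact (min_le_left _ _).trans (h i h')
          · exact min_le_right _ _
      let t' := min (t / 2) (min (e / 2) (c / 4))
      have ht' : 0 < t' := by positivity
      have h1 : t' ≤ t / 2 := min_le_left _ _
      have h2 : t' ≤ e / 2 := (min_le_right _ _).trans (min_le_left _ _)
      have h3 : t' ≤ c / 4 := (min_le_right _ _).trans (min_le_right _ _)
      obtain ⟨Q', hQQ', hne, hQ'⟩ := hnet (n + 1) Q (t' / 4) (by positivity)
      refine ⟨(t', Q', b + (Q ×ˢ Q).card), ⟨ht', hne, hQ'⟩, h1, hQQ', rfl,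
        fun i hi => ?_, fun v => ?_⟩
      · have := hcε i hi
        change 4 * t' ≤ ε i
        linarith
      · obtain ⟨z, hz, hd⟩ := h v
        refine ⟨z, hz, fun q hq => ?_⟩
        change 2 * t' ≤ dist z q
        by_contra! hlt
        refine Set.disjoint_right.1 hd (Finset.mem_coe.2 hq) (Metric.mem_closedBall.2 ?_)
        rw [dist_comm]
        linarith)
  obtain ⟨t, ht⟩ : ∃ t : ℕ → ℝ, t = fun n => (s n).1 := ⟨_, rfl⟩
  obtain ⟨Q, hQ⟩ : ∃ Q : ℕ → Finset G, Q = fun n => (s n).2.1 := ⟨_, rfl⟩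
  obtain ⟨b, hb⟩ : ∃ b : ℕ → ℕ, b = fun n => (s n).2.2 := ⟨_, rfl⟩
  have ht0 : t 0 = t₀ := by simp [ht, hs0]
  have hb0 : b 0 = 0 := by simp [hb, hs0]
  have htpos : ∀ n, 0 < t n := fun n => by rw [ht]; exact (hsP n).1
  have hQne : ∀ n, (Q n).Nonempty := fun n => by rw [hQ]; exact (hsP n).2.1
  have hQnet : ∀ n, ∀ x ∈ C n, ∃ q ∈ Q n, dist x q < t n / 4 := fun n => by
    rw [hQ, ht]; exact (hsP n).2.2
  have ht2 : ∀ n, t (n + 1) ≤ t n / 2 := fun n => by rw [ht]; exact (hsR n).1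
  have hQmono : Monotone Q := monotone_nat_of_le_succ fun n => by rw [hQ]; exact (hsR n).2.1
  have hbs : ∀ n, b (n + 1) = b n + (Q n ×ˢ Q n).card := fun n => by
    rw [hQ, hb]; exact (hsR n).2.2.1
  have htε : ∀ n, ∀ i < b (n + 1), 4 * t (n + 1) ≤ ε i := fun n => by
    rw [hb, ht]; exact (hsR n).2.2.2.1
  have hesc : ∀ n v, ∃ v', dist v' v < t n / 2 ∧ ∀ q ∈ Q n, 2 * t (n + 1) ≤ dist v' q :=
    fun n => by rw [hQ, ht]; exact (hsR n).2.2.2.2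
  clear hsR hsP hs0 ht hQ hb s hQ₀ hQ₀ne hfin hnet
  have hbmono : StrictMono b := strictMono_nat_of_lt_succ fun n => by
    have := Finset.card_pos.2 ((hQne n).product (hQne n))
    rw [hbs]
    omega
  have htanti : Antitone t := antitone_nat_of_succ_le fun n => by linarith [ht2 n, htpos n]
  have htle : ∀ n, t n ≤ t₀ * (1 / 2) ^ n := by
    intro n
    induction n with
    | zero => simp [ht0]
    | succ n ih => rw [pow_succ]; linarith [ht2 n]
  have htlim : ∀ r > 0, ∃ n, t n < r := by
    intro r hr
    obtain ⟨n, hn⟩ := exists_pow_lt_of_lt_one (div_pos hr ht₀) (by norm_num : (1 / 2 : ℝ) < 1)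
    refine ⟨n, (htle n).trans_lt ?_⟩
    rwa [lt_div_iff₀ ht₀, mul_comm] at hn
  let D : ℕ → Set G := fun n => ⋃ q ∈ Q n, Metric.ball q (t (n + 1))
  have hDdisj : ∀ n w r, r ≤ t (n + 1) → (∀ q ∈ Q n, 2 * t (n + 1) ≤ dist w q) →
      Disjoint (Metric.closedBall w r) (D n) := by
    intro n w r hr h
    refine Set.disjoint_left.2 fun y hy hyD => ?_
    obtain ⟨q, hq, hyq⟩ := Set.mem_iUnion₂.1 hyD
    have h1 := h q hq
    have h2 := dist_triangle_left w q y
    have h3 : dist y w ≤ r := hy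
    have h4 : dist y q < t (n + 1) := hyq
    linarith
  have hM : IsMeagre (⋃ n, D n)ᶜ := by
    have hopen : IsOpen (⋃ n, D n) :=
      isOpen_iUnion fun n => isOpen_biUnion fun q _ => Metric.isOpen_ball
    refine IsNowhereDense.isMeagre
      (hopen.isClosed_compl.isNowhereDense_iff.2 (interior_eq_empty_iff_dense_compl.2 ?_))
    rw [compl_compl]
    refine Metric.dense_iff.2 fun y r hr => ?_
    obtain ⟨n, hn⟩ := htlim r hr
    obtain ⟨m, hm⟩ := C.exists_mem y
    obtain ⟨q, hq, hyq⟩ := hQnet (max n m) y (C.subset (le_max_right _ _) hm)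
    refine ⟨q, ?_, Set.mem_iUnion.2 ⟨max n m, Set.mem_iUnion₂.2
      ⟨q, hq, Metric.mem_ball_self (htpos _)⟩⟩⟩
    rw [Metric.mem_ball, dist_comm]
    linarith [htanti (le_max_left n m), htpos (max n m)]
  obtain ⟨F, hFmono, hFc, hFnd, hF⟩ := (hX _ hM).exists_monotone_isCompact
  obtain ⟨k, hk0, -, hk⟩ := exists_seq_of_forall_exists (fun _ (_ : ℕ) => True)
    (fun j k k' => k < k' ∧ ∀ p, ∃ z, dist z p < t k / 4 ∧
      Disjoint (Metric.closedBall z (t k')) (F j)) 0 trivial (by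
      intro j k _
      obtain ⟨e, he, h⟩ := (hFc j).exists_forall_disjoint_closedBall (hFnd j)
        (div_pos (htpos k) four_pos)
      obtain ⟨n, hn⟩ := htlim e he
      refine ⟨max n (k + 1), trivial, by omega, fun p => ?_⟩
      obtain ⟨z, hz, hd⟩ := h p
      exact ⟨z, hz, hd.mono_left (Metric.closedBall_subset_closedBall
        ((htanti (le_max_left _ _)).trans hn.le))⟩)
  have hkmono : StrictMono k := strictMono_nat_of_lt_succ fun n => (hk n).1
  choose z hzp hzF using fun j => (hk j).2
  choose e he_inj he_mem using fun n => (Q n ×ˢ Q n).exists_injOn_nat_block (b n)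
  refine exists_isGammaGroupableCover_of_families hb0 hbmono hk0 hkmono
    (fun n i => {x | ∃ j, k j ≤ n ∧ n < k (j + 1) ∧ ∃ a ∈ Q n ×ˢ Q n, e n a = i ∧
      dist x (a.1⁻¹ * z j a.2) < 2 * t (n + 1)}) ?_ ?_
  · refine fun n i _ hi => Metric.ediam_le ?_
    rintro x ⟨j, hj1, hj2, a, ha, hai, hx⟩ y ⟨j', hj1', hj2', a', ha', hai', hy⟩
    have h1 : j < j' + 1 := hkmono.lt_iff_lt.1 (hj1.trans_lt hj2')
    have h2 : j' < j + 1 := hkmono.lt_iff_lt.1 (hj1'.trans_lt hj2)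
    obtain rfl : j = j' := by omega
    obtain rfl : a = a' := he_inj n ha ha' (hai.trans hai'.symm)
    rw [edist_dist]
    refine ENNReal.ofReal_le_ofReal ?_
    have h3 := dist_triangle_right x y (a.1⁻¹ * z j a.2)
    linarith [htε n i hi]
  · intro x hx
    -- `Below σ τ` refines the closed ball of the node `σ` to that of the deeper node `τ`.
    let B : ℕ × G → Set G := fun σ => Metric.closedBall σ.2 (t σ.1)
    let Below : ℕ × G → ℕ × G → Prop := fun σ τ => σ.1 ≤ τ.1 ∧ B τ ⊆ B σ ∧
      ∀ n, σ.1 ≤ n → n < τ.1 → Disjoint (B τ) (D n)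
    have hrefl : ∀ σ, Below σ σ := fun σ => ⟨le_rfl, subset_rfl, fun n h1 h2 => by omega⟩
    have htrans : ∀ σ τ υ, Below σ τ → Below τ υ → Below σ υ := by
      rintro σ τ υ ⟨h1, h2, h3⟩ ⟨h4, h5, h6⟩
      refine ⟨h1.trans h4, h5.trans h2, fun n hn1 hn2 => ?_⟩
      rcases lt_or_ge n τ.1 with h | h
      · exact (h3 n hn1 h).mono_left h5
      · exact h6 n h hn2
    have hext : ∀ σ m, σ.1 ≤ m → ∃ v, Below σ (m, v) := by
      intro σ m hm
      induction m, hm using Nat.le_induction with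
      | base => exact ⟨σ.2, hrefl σ⟩
      | succ m hm ih =>
        obtain ⟨v, hv⟩ := ih
        obtain ⟨w, hw, hwQ⟩ := hesc m v
        refine ⟨w, htrans _ _ _ hv ⟨Nat.le_succ m, ?_, fun n h1 h2 => ?_⟩⟩
        · refine Metric.closedBall_subset_closedBall' ?_
          dsimp only
          linarith [ht2 m]
        · obtain rfl : n = m := le_antisymm (Nat.lt_succ_iff.1 h2) h1
          exact hDdisj n w _ le_rfl hwQ
    -- Otherwise nested balls avoiding every `F i * x⁻¹` in turn shrink to a point `m ∈ M` with `m *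
    -- x` in no `F i`.
    obtain ⟨σ, i, hσ, hσi⟩ : ∃ σ i, Below (0, 1) σ ∧
        ∀ τ, Below σ τ → ∃ m ∈ B τ, m * x ∈ F i := by
      by_contra! hcon
      obtain ⟨τ, hτ0, hτP, hτR⟩ := exists_seq_of_forall_exists (fun _ τ => Below (0, 1) τ)
        (fun i τ τ' => Below τ τ' ∧ τ.1 < τ'.1 ∧ ∀ m ∈ B τ', m * x ∉ F i) (0, 1) (hrefl _) (by
          intro i τ hτ
          -- One forced extra level makes the depths unbounded, so the limit avoids every `D n`.
          obtain ⟨v, hv⟩ := hext τ (τ.1 + 1) (Nat.le_succ _)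
          obtain ⟨τ', hτ', hm⟩ := hcon _ i (htrans _ _ _ hτ hv)
          exact ⟨τ', htrans _ _ _ (htrans _ _ _ hτ hv) hτ', htrans _ _ _ hv hτ',
            Nat.lt_of_succ_le hτ'.1, hm⟩)
      have hlen : ∀ n, n ≤ (τ n).1 :=
        (strictMono_nat_of_lt_succ fun n => (hτR n).2.1 : StrictMono fun n => (τ n).1).id_le
      obtain ⟨m, hm⟩ := IsCompact.nonempty_iInter_of_sequence_nonempty_isCompact_isClosed
        (fun n => B (τ n)) (fun n => (hτR n).1.2.1)
        (fun n => ⟨(τ n).2, Metric.mem_closedBall_self (htpos _).le⟩)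
        (by rw [hτ0]; simpa only [B, ht0] using hC₀) fun n => Metric.isClosed_closedBall
      rw [Set.mem_iInter] at hm
      have hmM : m ∈ (⋃ n, D n)ᶜ := by
        intro hmD
        obtain ⟨n, hn⟩ := Set.mem_iUnion.1 hmD
        exact Set.disjoint_left.1 ((hτP (n + 1)).2.2 n (Nat.zero_le _)
          (Nat.lt_of_succ_le (hlen (n + 1)))) (hm (n + 1)) hn
      obtain ⟨i, hi⟩ := Set.mem_iUnion.1 (hF (Set.mul_mem_mul hmM hx))
      exact (hτR i).2.2 m (hm (i + 1)) hi
    obtain ⟨m₀, hm₀⟩ := C.exists_superset_of_isCompact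
      (hC₀.image (continuous_mul_const x))
    filter_upwards [eventually_ge_atTop (max m₀ (max i σ.1))] with j hj
    have hjk : j ≤ k j := hkmono.id_le j
    have hjm : m₀ ≤ k j := by omega
    have hji : i ≤ j := by omega
    obtain ⟨v, hv⟩ := hext σ (k j) (by omega)
    have hv1 : v ∈ Metric.closedBall (1 : G) t₀ := by
      rw [← ht0]
      exact (htrans _ _ _ hσ hv).2.1 (Metric.mem_closedBall_self (htpos _).le)
    obtain ⟨p, hp, hvp⟩ := hQnet (k j) (v * x) (C.subset hjm (hm₀ ⟨v, hv1, rfl⟩))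
    have hzv : dist (z j p * x⁻¹) v < t (k j) / 2 := by
      have h1 := dist_triangle_right (z j p) (v * x) p
      rw [← dist_mul_right (z j p * x⁻¹) v x, inv_mul_cancel_right]
      linarith [hzp j p]
    -- If no net point were close, the ball around `z j p * x⁻¹` would be a node below `σ`, yet its
    -- translate by `x` misses `F j ⊇ F i`.
    obtain ⟨n, hn1, hn2, q, hq, hqz⟩ : ∃ n, k j ≤ n ∧ n < k (j + 1) ∧ ∃ q ∈ Q n,
        dist (z j p * x⁻¹) q < 2 * t (n + 1) := by
      by_contra! hcon
      obtain ⟨m, hm, hmF⟩ := hσi (k (j + 1), z j p * x⁻¹) (htrans _ _ _ hv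
        ⟨(hk j).1.le, Metric.closedBall_subset_closedBall' (by
          have h1 := htanti (Nat.succ_le_of_lt (hk j).1)
          have h2 := ht2 (k j)
          dsimp only [Nat.succ_eq_add_one] at h1 ⊢
          linarith),
        fun n hn1 hn2 => hDdisj n _ _ (htanti hn2) (hcon n hn1 hn2)⟩)
      refine Set.disjoint_left.1 (hzF j p) (Metric.mem_closedBall.2 ?_) (hFmono hji hmF)
      rw [← dist_mul_right (m * x) (z j p) x⁻¹, mul_inv_cancel_right]
      simpa [B] using hm
    refine ⟨n, hn1, hn2, e n (q, p), (he_mem n _ ?_).1, ?_, j, hn1, hn2, (q, p), ?_, rfl, ?_⟩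
    · exact Finset.mk_mem_product hq (hQmono hn1 hp)
    · rw [hbs]
      exact (he_mem n _ (Finset.mk_mem_product hq (hQmono hn1 hp))).2
    · exact Finset.mk_mem_product hq (hQmono hn1 hp)
    · rw [← dist_mul_left q x, mul_inv_cancel_left, dist_comm,
        ← dist_mul_right (z j p) _ x⁻¹, mul_inv_cancel_right]
      exact hqz

end InvariantMetric

/-- A compatible invariant metric transfers both nontrivial implications to its own notion of
sharp measure zero. -/
theorem AdmitsInvariantMetric.exists_metricSpace {G : Type*} [Group G] [t : TopologicalSpace G]
    [IsTopologicalGroup G] [SecondCountableTopology G] [LocallyCompactSpace G]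
    (hG : AdmitsInvariantMetric G) (X : Set G) :
    ∃ d : MetricSpace G, d.toPseudoMetricSpace.toUniformSpace.toTopologicalSpace = t ∧
      (IsMeagerAdditive X → @HasSharpMeasureZero G d X) ∧
      (@HasSharpMeasureZero G d X → IsSharplyMeagerAdditive X) := by
  obtain ⟨d, rfl, hd⟩ := hG
  have : IsIsometricSMul G G :=
    ⟨fun c => Isometry.of_dist_eq fun x y => (hd x y c).1⟩
  have : IsIsometricSMul Gᵐᵒᵖ G :=
    ⟨fun c => Isometry.of_dist_eq fun x y => (hd x y c.unop).2⟩
  refine ⟨d, rfl, fun h => ?_, fun h => h.isSharplyMeagerAdditive⟩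
  -- Finite nets are nowhere dense only without isolated points; a discrete `G` is countable.
  by_cases hdisc : DiscreteTopology G
  · have : Countable G := countable_of_Lindelof_of_discrete
    exact X.to_countable.hasSharpMeasureZero
  · have : ∀ x : G, (nhdsWithin x {x}ᶜ).NeBot := by
      intro x
      by_contra hx
      rw [Filter.not_neBot, ← isOpen_singleton_iff_punctured_nhds] at hx
      refine hdisc (discreteTopology_of_isOpen_singleton_one ?_)
      have := hx.preimage (continuous_const_mul x)
      convert this using 1
      ext y
      simp
    exact h.hasSharpMeasureZero

/-- The metric carried by `G` is an arbitrary metric inducing its topology; it enters only the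
notion of sharp measure zero and need not be invariant. -/
theorem theorem5p2 {G : Type*} [Group G] [MetricSpace G] [IsTopologicalGroup G]
    [PolishSpace G] [LocallyCompactSpace G] (hG : AdmitsInvariantMetric G) (X : Set G) :
    [IsMeagerAdditive X, IsSharplyMeagerAdditive X, HasSharpMeasureZero X].TFAE := by
  rename_i m _ _ _
  tfae_have 2 → 1 := fun h M hM => by
    obtain ⟨K, -, hXK, hMK⟩ := h M hM
    exact hMK.mono (Set.mul_subset_mul_left hXK)
  obtain ⟨d, hd, h13, h32⟩ := hG.exists_metricSpace X
  tfae_have 1 → 3 := fun h => by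
    have hid : @Continuous G G d.toPseudoMetricSpace.toUniformSpace.toTopologicalSpace
        m.toPseudoMetricSpace.toUniformSpace.toTopologicalSpace id :=
      continuous_id_iff_le.2 hd.le
    have hσ : @SigmaCompactSpace G d.toPseudoMetricSpace.toUniformSpace.toTopologicalSpace := by
      rw [hd]; infer_instance
    have := @HasSharpMeasureZero.image G G d m hσ X (h13 h) id hid
    rwa [Set.image_id] at this
  tfae_have 3 → 2 := fun h => by
    have hid : @Continuous G G m.toPseudoMetricSpace.toUniformSpace.toTopologicalSpace
        d.toPseudoMetricSpace.toUniformSpace.toTopologicalSpace id :=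
      continuous_id_iff_le.2 hd.ge
    have := @HasSharpMeasureZero.image G G m d inferInstance X h id hid
    rw [Set.image_id] at this
    exact h32 this
  tfae_finish
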